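/- Let $n\ge 1$ be an integer and let $m=(m_1,\dots,m_n)\in\mathbb{R}^n$; put $m_0=1$. For a real polynomial $P(x)=\sum_{k=0}^n p_kx^k$ of degree at most $n$ write $L_P(m)=\sum_{k=0}^n p_km_k$. For $k\ge 0$ let $\mathcal{P}_k$ be the set of monic real polynomials of degree $k$ which have $k$ distinct roots in $\mathbb{N}_0=\{0,1,2,\dots\}$ and are nonnegative at every point of $\mathbb{N}_0$ (so $\mathcal{P}_0=\{1\}$). Then there is a probability measure $\mu$ on $\mathbb{N}_0$ with finite moments up to order $n$ and $\int x^k\,d\mu(x)=m_k$ for $k=1,\dots,n$ if and only if both of the following conditions hold: (i) $L_P(m)\ge 0$ for every $P\in\mathcal{P}_n$; (ii) for every $P\in\mathcal{P}_{n-1}$, $L_P(m)\ge 0$, and if $L_P(m)=0$ then $L_{xP}(m)=0$, where $xP$ denotes the polynomial $x\mapsto xP(x)$. -/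

import Mathlib

open MeasureTheory Polynomial

namespace TruncatedMoment

/-- The moments `m_0, m_1, …, m_n`, where `m_0 = 1` and `m = (m_1, …, m_n)`; thus `m i` is
`m_{i+1}` for `i : Fin n`. -/
def moments {n : ℕ} (m : Fin n → ℝ) : Fin (n + 1) → ℝ :=
  Fin.cons 1 m

/-- The affine function `L_P(m) = ∑_{k=0}^n p_k m_k` of `m`, for a polynomial
`P = ∑_{k=0}^n p_k x^k` of degree at most `n`. -/
noncomputable def L {n : ℕ} (P : ℝ[X]) (m : Fin n → ℝ) : ℝ :=
  ∑ k : Fin (n + 1), P.coeff k * moments m k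

/-- The set of monic polynomials of degree `n` which have `n` distinct roots in, and are
nonnegative on, the nonnegative integers. -/
def PolySet (n : ℕ) : Set ℝ[X] :=
  {P | P.Monic ∧ P.natDegree = n ∧
    (∃ s : Finset ℕ, s.card = n ∧ ∀ j ∈ s, P.IsRoot (j : ℝ)) ∧
    ∀ j : ℕ, 0 ≤ P.eval (j : ℝ)}

/-- `m = (m_1, …, m_n)` is the vector of the first `n` moments of a probability measure on the
nonnegative integers. -/
def Realizable {n : ℕ} (m : Fin n → ℝ) : Prop :=
  ∃ μ : Measure ℕ, IsProbabilityMeasure μ ∧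
    ∀ i : Fin n, Integrable (fun j : ℕ => (j : ℝ) ^ ((i : ℕ) + 1)) μ ∧
      ∫ j : ℕ, (j : ℝ) ^ ((i : ℕ) + 1) ∂μ = m i

end TruncatedMoment

/-! Necessity: integrate `P ≥ 0`; a zero integral makes `P`, hence `xP`, vanish almost everywhere.
Sufficiency: multiplying by `(x - i)(x - i - 1)` and letting `i` grow carries positivity from
degrees `n` and `n - 1` to all `PolySet k`, `k ≤ n`. By moving roots into place, it then extends to
every polynomial of degree at most `n` that is nonnegative on `ℕ` (`nonneg_of_nonneg_polySet`).
Compactifying the moment curve by one point at infinity gives `L Q m = ∑ a_j Q(j) + c * Q.coeff n`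
with `a_j, c ≥ 0` (`exists_atoms`). If `c = 0`, the atoms realize `m`. If `m` is not realizable,
weak separation gives `Q ≠ 0`, nonnegative on `ℕ`, with `L Q m = 0`. As `c > 0`, `Q` has degree
below `n` and vanishes at every charged atom. Some `P ∈ PolySet (n - 1)` inherits these zeros, so `L
P m = 0` while `L (X * P) m = c ≠ 0`, against (ii). -/

namespace TruncatedMoment

/-! ### Polynomials nonnegative on `ℕ` and their natural roots -/

/-- The natural numbers that are roots of a real polynomial. -/
noncomputable def natRoots (Q : ℝ[X]) : Finset ℕ :=
  Q.roots.toFinset.preimage (fun j : ℕ => (j : ℝ)) Nat.cast_injective.injOn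

/-- The monic polynomial whose roots are the elements of `s`. -/
noncomputable def rootPoly (s : Finset ℕ) : ℝ[X] := ∏ j ∈ s, (X - C (j : ℝ))

theorem mem_natRoots {Q : ℝ[X]} (hQ : Q ≠ 0) {j : ℕ} : j ∈ natRoots Q ↔ Q.eval (j : ℝ) = 0 := by
  simp [natRoots, hQ]

theorem card_natRoots_le (Q : ℝ[X]) : (natRoots Q).card ≤ Q.natDegree := by
  classical
  calc (natRoots Q).card = ((natRoots Q).image (fun j : ℕ => (j : ℝ))).card :=
        (Finset.card_image_of_injective _ Nat.cast_injective).symm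
    _ ≤ Q.roots.toFinset.card := Finset.card_le_card <|
        Finset.image_subset_iff.2 fun j hj => Finset.mem_preimage.1 hj
    _ ≤ Q.natDegree := (Multiset.toFinset_card_le _).trans (card_roots' Q)

theorem rootPoly_monic (s : Finset ℕ) : (rootPoly s).Monic :=
  monic_prod_of_monic _ _ fun _ _ => monic_X_sub_C _

theorem natDegree_rootPoly (s : Finset ℕ) : (rootPoly s).natDegree = s.card := by
  rw [rootPoly, natDegree_prod_of_monic _ _ fun _ _ => monic_X_sub_C _]
  simp only [natDegree_X_sub_C, Finset.sum_const, smul_eq_mul, mul_one]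

theorem eval_rootPoly_eq_zero {s : Finset ℕ} {j : ℕ} :
    (rootPoly s).eval (j : ℝ) = 0 ↔ j ∈ s := by
  simp only [rootPoly, eval_prod, Finset.prod_eq_zero_iff, eval_sub, eval_X, eval_C, sub_eq_zero,
    Nat.cast_inj]
  exact ⟨fun ⟨a, ha, h⟩ => h ▸ ha, fun h => ⟨j, h, rfl⟩⟩

theorem exists_eval_rootPoly_pos (s : Finset ℕ) : ∃ j : ℕ, 0 < (rootPoly s).eval (j : ℝ) := by
  refine ⟨s.sup id + 1, ?_⟩
  rw [rootPoly, eval_prod]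
  refine Finset.prod_pos fun i hi => ?_
  have h : i ≤ s.sup id := Finset.le_sup (f := id) hi
  have : (i : ℝ) ≤ (s.sup id : ℕ) := by exact_mod_cast h
  simp only [eval_sub, eval_X, eval_C]
  push_cast
  linarith

theorem leadingCoeff_pos_of_nonneg {Q : ℝ[X]} (hQ : Q ≠ 0) (h : ∀ j : ℕ, 0 ≤ Q.eval (j : ℝ)) :
    0 < Q.leadingCoeff := by
  by_contra! hc
  have hlt : Q.leadingCoeff < 0 := lt_of_le_of_ne hc (leadingCoeff_ne_zero.2 hQ)
  rcases Nat.eq_zero_or_pos Q.natDegree with h0 | h0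
  · rw [eq_C_of_natDegree_eq_zero h0] at h hlt
    have := h 0
    simp at this hlt
    linarith
  · have ht := (Q.tendsto_atBot_of_leadingCoeff_nonpos (natDegree_pos_iff_degree_pos.1 h0)
      hc).comp tendsto_natCast_atTop_atTop
    obtain ⟨j, hj⟩ := (ht.eventually (Filter.eventually_lt_atBot 0)).exists
    exact absurd (h j) (not_le.2 hj)

/-- Adding a suitable multiple of `T`, of lower degree, to `Q` creates a new root and keeps the
old ones, the degree, and nonnegativity. -/
theorem exists_add_smul_nonneg {Q T : ℝ[X]} (h : ∀ j : ℕ, 0 ≤ Q.eval (j : ℝ))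
    (hdeg : T.natDegree < Q.natDegree) (hT : ∀ j : ℕ, Q.eval (j : ℝ) = 0 → T.eval (j : ℝ) = 0)
    (hneg : ∃ j : ℕ, T.eval (j : ℝ) < 0) :
    ∃ t : ℝ, 0 < t ∧ (∀ j : ℕ, 0 ≤ (Q + t • T).eval (j : ℝ)) ∧ Q + t • T ≠ 0 ∧
      (Q + t • T).natDegree = Q.natDegree ∧ (natRoots Q).card < (natRoots (Q + t • T)).card ∧
      ∀ j : ℕ, Q.eval (j : ℝ) = 0 → (Q + t • T).eval (j : ℝ) = 0 := by
  obtain ⟨j₀, hj₀⟩ := hneg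
  have hQ : Q ≠ 0 := by rintro rfl; simp at hdeg
  have hlt (t : ℝ) : (t • T).natDegree < Q.natDegree := (natDegree_smul_le t T).trans_lt hdeg
  have hnd (t : ℝ) : (Q + t • T).natDegree = Q.natDegree :=
    natDegree_add_eq_left_of_natDegree_lt (hlt t)
  have hlc (t : ℝ) : (Q + t • T).leadingCoeff = Q.leadingCoeff :=
    leadingCoeff_add_of_degree_lt' (degree_lt_degree (hlt t))
  have hne (t : ℝ) : Q + t • T ≠ 0 := by
    intro h0
    have := hnd t
    rw [h0] at this
    simp at this
    omega
  -- `M` is the parameter at which the value at `j₀` reaches zero, so it bounds the first hitting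
  -- time. `Q + M • T` is eventually nonnegative, so the minimum below needs only a finite window.
  set M : ℝ := Q.eval (j₀ : ℝ) / (-T.eval (j₀ : ℝ)) with hM
  have htend := ((Q + M • T).tendsto_atTop_of_leadingCoeff_nonneg
    (natDegree_pos_iff_degree_pos.1 (by rw [hnd]; omega))
    (by rw [hlc]; exact (leadingCoeff_pos_of_nonneg hQ h).le)).comp
      (tendsto_natCast_atTop_atTop (R := ℝ))
  obtain ⟨N, hN⟩ := Filter.eventually_atTop.1 (htend.eventually (Filter.eventually_ge_atTop 0))
  classical
  obtain ⟨j₁, hj₁, hmin⟩ := Finset.exists_min_image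
    ((Finset.range (N + j₀ + 1)).filter fun j : ℕ => T.eval (j : ℝ) < 0)
    (fun j : ℕ => Q.eval (j : ℝ) / (-T.eval (j : ℝ)))
    ⟨j₀, by simp only [Finset.mem_filter, Finset.mem_range]; exact ⟨by omega, hj₀⟩⟩
  simp only [Finset.mem_filter, Finset.mem_range] at hj₁ hmin
  have hQ₁ : Q.eval (j₁ : ℝ) ≠ 0 := fun h0 => by
    have := hT _ h0
    linarith [hj₁.2]
  set t : ℝ := Q.eval (j₁ : ℝ) / (-T.eval (j₁ : ℝ)) with ht
  have htM : t ≤ M := hmin j₀ ⟨by omega, hj₀⟩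
  have htpos : 0 < t := div_pos (lt_of_le_of_ne (h _) hQ₁.symm) (by linarith [hj₁.2])
  have hold : ∀ j : ℕ, Q.eval (j : ℝ) = 0 → (Q + t • T).eval (j : ℝ) = 0 := fun j hj => by
    simp [hj, hT j hj]
  have hnew : (Q + t • T).eval (j₁ : ℝ) = 0 := by
    have : T.eval (j₁ : ℝ) ≠ 0 := hj₁.2.ne
    simp only [eval_add, eval_smul, smul_eq_mul, ht]
    field_simp
    ring
  refine ⟨t, htpos, fun j => ?_, hne t, hnd t, ?_, hold⟩
  · simp only [eval_add, eval_smul, smul_eq_mul]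
    rcases le_or_gt 0 (T.eval (j : ℝ)) with h0 | h0
    · have := h j
      positivity
    · rcases lt_or_ge j (N + j₀ + 1) with hj | hj
      · have := hmin j ⟨hj, h0⟩
        rw [le_div_iff₀ (by linarith)] at this
        linarith
      · have := hN j (by omega)
        simp only [Function.comp, eval_add, eval_smul, smul_eq_mul] at this
        nlinarith
  · refine Finset.card_lt_card (Finset.ssubset_iff_subset_ne.2 ⟨fun j hj => ?_, fun he => ?_⟩)
    · exact (mem_natRoots (hne t)).2 (hold j ((mem_natRoots hQ).1 hj))
    · exact hQ₁ ((mem_natRoots hQ).1 (he ▸ (mem_natRoots (hne t)).2 hnew))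

theorem inv_smul_mem_polySet {Q : ℝ[X]} (hQ : Q ≠ 0) (h : ∀ j : ℕ, 0 ≤ Q.eval (j : ℝ))
    (hcard : (natRoots Q).card = Q.natDegree) :
    Q.leadingCoeff⁻¹ • Q ∈ PolySet Q.natDegree := by
  have hlc := leadingCoeff_pos_of_nonneg hQ h
  refine ⟨?_, ?_, ⟨natRoots Q, hcard, fun j hj => ?_⟩, fun j => ?_⟩
  · rw [Monic, leadingCoeff_smul_of_smul_regular _ (IsSMulRegular.of_ne_zero (inv_ne_zero hlc.ne'))]
    simp [hlc.ne']
  · exact natDegree_smul _ (inv_ne_zero hlc.ne')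
  · simp [IsRoot, (mem_natRoots hQ).1 hj]
  · have := h j
    simp only [eval_smul, smul_eq_mul]
    positivity

theorem rootPoly_mem_polySet {s : Finset ℕ} (h : ∀ j : ℕ, 0 ≤ (rootPoly s).eval (j : ℝ)) :
    rootPoly s ∈ PolySet s.card :=
  ⟨rootPoly_monic s, natDegree_rootPoly s, ⟨s, rfl, fun _ hj => eval_rootPoly_eq_zero.2 hj⟩, h⟩

/-- Subtracting multiples of `rootPoly (natRoots Q)` adds roots without losing any, until their
number equals the degree. -/
theorem exists_mem_polySet_of_nonneg {Q : ℝ[X]} (hQ : Q ≠ 0) (h : ∀ j : ℕ, 0 ≤ Q.eval (j : ℝ)) :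
    ∃ k ≤ Q.natDegree, ∃ P ∈ PolySet k, ∀ j : ℕ, Q.eval (j : ℝ) = 0 → P.eval (j : ℝ) = 0 := by
  induction hr : Q.natDegree - (natRoots Q).card using Nat.strong_induction_on generalizing Q with
  | _ r ih =>
    rcases (card_natRoots_le Q).eq_or_lt with heq | hlt
    · exact ⟨_, le_rfl, _, inv_smul_mem_polySet hQ h heq, fun j hj => by simp [hj]⟩
    · obtain ⟨j₀, hj₀⟩ := exists_eval_rootPoly_pos (natRoots Q)
      obtain ⟨t, -, hnn, hne, hnd, hcard, hold⟩ := exists_add_smul_nonneg h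
        (T := -rootPoly (natRoots Q)) (by rwa [natDegree_neg, natDegree_rootPoly])
        (fun j hj => by simpa using eval_rootPoly_eq_zero.2 ((mem_natRoots hQ).2 hj))
        ⟨j₀, by simpa using hj₀⟩
      obtain ⟨k, hk, P, hP, hroot⟩ := ih _ (by omega) hne hnn rfl
      exact ⟨k, hk.trans hnd.le, P, hP, fun j hj => hroot j (hold j hj)⟩

/-- A linear functional that is nonnegative on the sets `PolySet k`, `k ≤ n`, is nonnegative on
the polynomials of degree at most `n` that are nonnegative on the natural numbers. -/
theorem nonneg_of_nonneg_polySet {n : ℕ} (Λ : ℝ[X] →ₗ[ℝ] ℝ)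
    (hΛ : ∀ k ≤ n, ∀ P ∈ PolySet k, 0 ≤ Λ P) {Q : ℝ[X]} (hQ : Q ≠ 0) (hdeg : Q.natDegree ≤ n)
    (h : ∀ j : ℕ, 0 ≤ Q.eval (j : ℝ)) : 0 ≤ Λ Q := by
  induction hr : Q.natDegree - (natRoots Q).card using Nat.strong_induction_on generalizing Q with
  | _ r ih =>
    rcases (card_natRoots_le Q).eq_or_lt with heq | hlt
    · have := hΛ _ hdeg _ (inv_smul_mem_polySet hQ h heq)
      rw [map_smul, smul_eq_mul] at this
      exact (mul_nonneg_iff_of_pos_left (inv_pos.2 (leadingCoeff_pos_of_nonneg hQ h))).1 this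
    · set R := rootPoly (natRoots Q) with hR
      have hvan : ∀ j : ℕ, Q.eval (j : ℝ) = 0 → R.eval (j : ℝ) = 0 := fun j hj =>
        eval_rootPoly_eq_zero.2 ((mem_natRoots hQ).2 hj)
      have hRdeg : R.natDegree < Q.natDegree := by rwa [natDegree_rootPoly]
      obtain ⟨j₀, hj₀⟩ := exists_eval_rootPoly_pos (natRoots Q)
      obtain ⟨t, ht, hnn, hne, hnd, hcard, hold⟩ := exists_add_smul_nonneg h
        (T := -R) (by rwa [natDegree_neg]) (fun j hj => by simp [hvan j hj])
        ⟨j₀, by simpa using hj₀⟩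
      have h₁ := ih _ (by omega) hne (hnd.trans_le hdeg) hnn rfl
      simp only [map_add, map_smul, map_neg, smul_eq_mul] at h₁
      -- If `R` is nonnegative on `ℕ`, then `Q = (Q - tR) + tR` with `R` in the class. Otherwise `Q
      -- + uR` also gains a root, and `(t + u)Q = u(Q - tR) + t(Q + uR)`.
      by_cases hpos : ∀ j : ℕ, 0 ≤ R.eval (j : ℝ)
      · have := hΛ _ (hlt.le.trans hdeg) _ (rootPoly_mem_polySet hpos)
        nlinarith
      · push Not at hpos
        obtain ⟨u, hu, hnn', hne', hnd', hcard', hold'⟩ := exists_add_smul_nonneg h hRdeg hvan hpos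
        have h₂ := ih _ (by omega) hne' (hnd'.trans_le hdeg) hnn' rfl
        simp only [map_add, map_smul, smul_eq_mul] at h₂
        have h₃ : 0 ≤ (t + u) * Λ Q := by nlinarith
        exact (mul_nonneg_iff_of_pos_left (by positivity)).1 h₃

/-! ### Changing the degree within `PolySet` -/

theorem exists_finset_of_mem_polySet {k : ℕ} {P : ℝ[X]} (hP : P ∈ PolySet k) :
    ∃ s : Finset ℕ, s.card = k ∧ ∀ j : ℕ, P.eval (j : ℝ) = 0 ↔ j ∈ s := by
  obtain ⟨hmon, hdeg, ⟨s, hs, hroot⟩, -⟩ := hP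
  have hsub : s ⊆ natRoots P := fun j hj => (mem_natRoots hmon.ne_zero).2 (hroot j hj)
  have := Finset.eq_of_subset_of_card_le hsub (by rw [hs, ← hdeg]; exact card_natRoots_le P)
  exact ⟨s, hs, fun j => by rw [this, mem_natRoots hmon.ne_zero]⟩

/-- Multiplying by the linear factor at the smallest natural non-root stays in the class. -/
theorem exists_mul_mem_polySet_succ {k : ℕ} {P : ℝ[X]} (hP : P ∈ PolySet k) :
    ∃ t : ℕ, (X - C (t : ℝ)) * P ∈ PolySet (k + 1) := by
  classical
  obtain ⟨s, hs, hroot⟩ := exists_finset_of_mem_polySet hP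
  obtain ⟨hmon, hdeg, -, hnn⟩ := hP
  have hex : ∃ t, t ∉ s := s.exists_notMem
  refine ⟨Nat.find hex, (monic_X_sub_C _).mul hmon, ?_, ⟨insert (Nat.find hex) s, ?_, ?_⟩, ?_⟩
  · rw [(monic_X_sub_C _).natDegree_mul hmon, natDegree_X_sub_C, hdeg, add_comm]
  · rw [Finset.card_insert_of_notMem (Nat.find_spec hex), hs]
  · intro j hj
    rcases Finset.mem_insert.1 hj with rfl | hj
    · simp
    · simp [(hroot j).2 hj]
  · intro j
    rw [eval_mul, eval_sub, eval_X, eval_C]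
    rcases lt_or_ge j (Nat.find hex) with h | h
    · rw [(hroot j).2 (not_not.1 (Nat.find_min hex h)), mul_zero]
    · exact mul_nonneg (sub_nonneg.2 (by exact_mod_cast h)) (hnn j)

theorem exists_mem_polySet_of_le {k l : ℕ} (hkl : k ≤ l) {P : ℝ[X]} (hP : P ∈ PolySet k) :
    ∃ P' ∈ PolySet l, ∀ j : ℕ, P.eval (j : ℝ) = 0 → P'.eval (j : ℝ) = 0 := by
  induction l, hkl using Nat.le_induction with
  | base => exact ⟨P, hP, fun _ => id⟩
  | succ l _ ih =>
    obtain ⟨P', hP', h⟩ := ih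
    obtain ⟨t, ht⟩ := exists_mul_mem_polySet_succ hP'
    exact ⟨_, ht, fun j hj => by simp [h j hj]⟩

/-- No integer lies strictly between `i` and `i + 1`, so the quadratic factor is nonnegative on `ℕ`;
beyond the largest given root both new roots are distinct from the old ones. -/
theorem exists_mul_mem_polySet_add_two {k : ℕ} {P : ℝ[X]} (hP : P ∈ PolySet k) :
    ∃ N : ℕ, ∀ i ≥ N, (X - C (i : ℝ)) * ((X - C ((i + 1 : ℕ) : ℝ)) * P) ∈ PolySet (k + 2) := by
  classical
  obtain ⟨hmon, hdeg, ⟨s, hs, hroot⟩, hnn⟩ := hP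
  refine ⟨s.sup id + 1, fun i hi => ⟨(monic_X_sub_C _).mul ((monic_X_sub_C _).mul hmon), ?_,
    ⟨insert i (insert (i + 1) s), ?_, ?_⟩, ?_⟩⟩
  · rw [(monic_X_sub_C _).natDegree_mul ((monic_X_sub_C _).mul hmon),
      (monic_X_sub_C _).natDegree_mul hmon, natDegree_X_sub_C, natDegree_X_sub_C, hdeg]
    ring
  · have hle : ∀ j ∈ s, j < i := fun j hj => by
      have : j ≤ s.sup id := Finset.le_sup (f := id) hj
      omega
    have h1 : i + 1 ∉ s := fun h => by have := hle _ h; omega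
    have h2 : i ∉ insert (i + 1) s := fun h => by
      rcases Finset.mem_insert.1 h with h | h
      · omega
      · exact (hle _ h).false
    rw [Finset.card_insert_of_notMem h2, Finset.card_insert_of_notMem h1, hs]
  · intro j hj
    simp only [Finset.mem_insert] at hj
    rcases hj with rfl | rfl | hj
    · simp
    · simp
    · simp [(hroot j hj).eq_zero]
  · intro j
    rw [eval_mul, eval_mul, ← mul_assoc]
    refine mul_nonneg ?_ (hnn j)
    simp only [eval_sub, eval_X, eval_C]
    rcases le_or_gt j i with h | h
    · have : (j : ℝ) ≤ i := by exact_mod_cast h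
      push_cast
      nlinarith
    · have : ((i + 1 : ℕ) : ℝ) ≤ j := by exact_mod_cast h
      push_cast at this ⊢
      nlinarith

/-- As `i → ∞`, the term `i² Λ P` dominates `Λ ((X - i)(X - i - 1)P)`. -/
theorem nonneg_of_nonneg_add_two {k : ℕ} (Λ : ℝ[X] →ₗ[ℝ] ℝ)
    (hΛ : ∀ P ∈ PolySet (k + 2), 0 ≤ Λ P) {P : ℝ[X]} (hP : P ∈ PolySet k) : 0 ≤ Λ P := by
  obtain ⟨N, hN⟩ := exists_mul_mem_polySet_add_two hP
  have key : ∀ i ≥ N, 0 ≤ Λ (X ^ 2 * P) - (2 * i + 1) * Λ (X * P) + i * (i + 1) * Λ P := by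
    intro i hi
    have h := hΛ _ (hN i hi)
    have e : (X - C (i : ℝ)) * ((X - C ((i + 1 : ℕ) : ℝ)) * P) =
        X ^ 2 * P - (2 * i + 1 : ℝ) • (X * P) + (i * (i + 1) : ℝ) • P := by
      simp only [smul_eq_C_mul, Nat.cast_add, Nat.cast_one, map_add, map_mul, map_one, map_ofNat]
      ring
    rw [e] at h
    simpa only [map_add, map_sub, map_smul, smul_eq_mul] using h
  by_contra! hneg
  have hlim : Filter.Tendsto (fun i : ℕ => (i : ℝ) * (-Λ P)) Filter.atTop Filter.atTop :=
    tendsto_natCast_atTop_atTop.atTop_mul_const (by linarith)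
  -- The factor 3 comes from `2i + 1 ≤ 3i` for `i ≥ 1`.
  obtain ⟨i, h1, h2, h3⟩ := ((hlim.eventually (Filter.eventually_ge_atTop
    (|Λ (X ^ 2 * P)| + 3 * |Λ (X * P)| + 1))).and
      ((Filter.eventually_ge_atTop N).and (Filter.eventually_ge_atTop 1))).exists
  have hk := key i h2
  have hi : (1 : ℝ) ≤ i := by exact_mod_cast h3
  have a1 := le_abs_self (Λ (X ^ 2 * P))
  have a2 := neg_abs_le (Λ (X * P))
  have b1 := abs_nonneg (Λ (X ^ 2 * P))
  have b2 := abs_nonneg (Λ (X * P))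
  have c1 : (i : ℝ) * (|Λ (X ^ 2 * P)| + 3 * |Λ (X * P)| + 1) ≤ i * (i * (-Λ P)) :=
    mul_le_mul_of_nonneg_left h1 (by linarith)
  nlinarith [mul_nonneg (sub_nonneg.2 hi) b1, mul_nonneg (sub_nonneg.2 hi) b2]

theorem nonneg_polySet_of_le {n : ℕ} (hn : 1 ≤ n) (Λ : ℝ[X] →ₗ[ℝ] ℝ)
    (h₀ : ∀ P ∈ PolySet n, 0 ≤ Λ P) (h₁ : ∀ P ∈ PolySet (n - 1), 0 ≤ Λ P) :
    ∀ k ≤ n, ∀ P ∈ PolySet k, 0 ≤ Λ P := by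
  intro k hk
  obtain ⟨d, hd⟩ := Nat.exists_eq_add_of_le hk
  induction d using Nat.strong_induction_on generalizing k with
  | _ d ih =>
    rcases d with _ | _ | d
    · rwa [← show n = k by omega]
    · rwa [← show n - 1 = k by omega]
    · exact fun P hP => nonneg_of_nonneg_add_two Λ (ih d (by omega) (k + 2) (by omega) (by omega)) hP

/-! ### The moment functional in coordinates -/

/-- `P ↦ L P m` as a linear map. -/
noncomputable def momentFunctional {n : ℕ} (m : Fin n → ℝ) : ℝ[X] →ₗ[ℝ] ℝ where
  toFun P := L P m
  map_add' P Q := by simp [L, add_mul, Finset.sum_add_distrib]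
  map_smul' c P := by simp [L, mul_assoc, Finset.mul_sum]

theorem momentFunctional_apply {n : ℕ} (m : Fin n → ℝ) (P : ℝ[X]) :
    momentFunctional m P = L P m := rfl

theorem eval_eq_sum_fin {n : ℕ} {Q : ℝ[X]} (hQ : Q.natDegree ≤ n) (x : ℝ) :
    Q.eval x = ∑ k : Fin (n + 1), Q.coeff k * x ^ (k : ℕ) := by
  rw [eval_eq_sum_range' (Nat.lt_succ_of_le hQ), Finset.sum_range]

theorem coeff_ofFn {N : ℕ} (p : Fin N → ℝ) (k : Fin N) : (ofFn N p).coeff k = p k := by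
  rw [ofFn_coeff_eq_val_of_lt _ k.2]

theorem natDegree_ofFn_le {n : ℕ} (p : Fin (n + 1) → ℝ) : (ofFn (n + 1) p).natDegree ≤ n :=
  Nat.le_of_lt_succ (ofFn_natDegree_lt (Nat.succ_pos n) p)

theorem eval_ofFn {n : ℕ} (p : Fin (n + 1) → ℝ) (x : ℝ) :
    (ofFn (n + 1) p).eval x = ∑ k : Fin (n + 1), p k * x ^ (k : ℕ) := by
  simp_rw [eval_eq_sum_fin (natDegree_ofFn_le p), coeff_ofFn]

theorem L_ofFn {n : ℕ} (p : Fin (n + 1) → ℝ) (m : Fin n → ℝ) :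
    L (ofFn (n + 1) p) m = ∑ k : Fin (n + 1), p k * moments m k := by
  simp_rw [L, coeff_ofFn]

theorem L_one {n : ℕ} (m : Fin n → ℝ) : L 1 m = 1 := by
  simp [L, moments, coeff_one]

theorem L_X_pow {n : ℕ} (m : Fin n → ℝ) (k : Fin (n + 1)) : L (X ^ (k : ℕ)) m = moments m k := by
  simp [L, coeff_X_pow, Fin.val_inj]

theorem linearMap_apply_eq_sum_single {ι : Type*} [Fintype ι] [DecidableEq ι]
    (f : (ι → ℝ) →ₗ[ℝ] ℝ) (x : ι → ℝ) : f x = ∑ k, f (Pi.single k 1) * x k := by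
  conv_lhs => rw [pi_eq_sum_univ' x]
  simp [mul_comm]

/-! ### Compactified moment curve and the atomic representation -/

/-- The moment curve, scaled to be bounded. -/
noncomputable def scaledCurve (n j : ℕ) : Fin (n + 1) → ℝ :=
  fun k => (j : ℝ) ^ (k : ℕ) / ((j : ℝ) ^ n + 1)

theorem tendsto_scaledCurve {n : ℕ} (hn : 1 ≤ n) :
    Filter.Tendsto (scaledCurve n) Filter.atTop (nhds (Pi.single (Fin.last n) 1)) := by
  have hdeg : (X ^ n + 1 : ℝ[X]).degree = n := by simpa using degree_X_pow_add_C hn (1 : ℝ)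
  have hmon : (X ^ n + 1 : ℝ[X]).Monic := by
    simpa using monic_X_pow_add_C (1 : ℝ) (by omega : n ≠ 0)
  refine tendsto_pi_nhds.2 fun k => ?_
  rcases eq_or_ne k (Fin.last n) with rfl | hk
  · have := (div_tendsto_atTop_leadingCoeff_div_of_degree_eq (X ^ n : ℝ[X]) (X ^ n + 1)
      (by rw [hdeg, degree_X_pow])).comp tendsto_natCast_atTop_atTop
    simpa [hmon.leadingCoeff, Function.comp_def, scaledCurve] using this
  · have hlt : (k : ℕ) < n := Fin.val_lt_last hk
    have := (div_tendsto_atTop_zero_of_degree_lt (X ^ (k : ℕ) : ℝ[X]) (X ^ n + 1)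
      (by rw [hdeg, degree_X_pow]; exact_mod_cast hlt)).comp tendsto_natCast_atTop_atTop
    simpa [Function.comp_def, scaledCurve, hk] using this

theorem sum_coeff_mul_scaledCurve {n : ℕ} {Q : ℝ[X]} (hQ : Q.natDegree ≤ n) (j : ℕ) :
    ∑ k : Fin (n + 1), Q.coeff k * scaledCurve n j k = Q.eval (j : ℝ) / ((j : ℝ) ^ n + 1) := by
  simp_rw [eval_eq_sum_fin hQ, Finset.sum_div, scaledCurve, mul_div_assoc]

/-- In finite dimension the convex hull of a compact set is compact. -/
theorem isCompact_convexHull_of_isCompact {E : Type*} [NormedAddCommGroup E] [NormedSpace ℝ E]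
    [FiniteDimensional ℝ E] {A : Set E} (hA : IsCompact A) : IsCompact (convexHull ℝ A) := by
  classical
  obtain rfl | ⟨x₀, hx₀⟩ := A.eq_empty_or_nonempty
  · simp
  -- Carathéodory: `d` points always suffice, and shorter combinations are padded with zero weights
  -- at `x₀`.
  set d := Module.finrank ℝ E + 1 with hd
  have hcompact := ((isCompact_stdSimplex ℝ (Fin d)).prod
    (isCompact_univ_pi fun _ : Fin d => hA)).image
    (f := fun q : (Fin d → ℝ) × (Fin d → E) => ∑ i, q.1 i • q.2 i) (by fun_prop)
  convert hcompact using 1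
  refine Set.Subset.antisymm (fun x hx => ?_) ?_
  · obtain ⟨ι, _, z, w, hz, hind, hw, hw₁, rfl⟩ := eq_pos_convex_span_of_mem_convexHull hx
    have hcard : Fintype.card ι ≤ Fintype.card (Fin d) := by
      rw [Fintype.card_fin]
      exact hind.card_le_finrank_succ.trans (Nat.succ_le_succ (Submodule.finrank_le _))
    obtain ⟨e⟩ := Function.Embedding.nonempty_of_card_le hcard
    refine ⟨(Function.extend e w 0, Function.extend e z fun _ => x₀), ⟨⟨fun i => ?_, ?_⟩, ?_⟩, ?_⟩
    · by_cases hi : ∃ a, e a = i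
      · obtain ⟨a, rfl⟩ := hi
        simpa [e.injective.extend_apply] using (hw a).le
      · simp [Function.extend_apply' _ _ _ hi]
    · rw [← hw₁]
      refine (Fintype.sum_of_injective e e.injective _ _ (fun i hi => ?_) fun a => ?_).symm
      · exact Function.extend_apply' _ _ _ hi
      · simp [e.injective.extend_apply]
    · rintro i -
      by_cases hi : ∃ a, e a = i
      · obtain ⟨a, rfl⟩ := hi
        simpa [e.injective.extend_apply] using hz ⟨a, rfl⟩
      · simpa [Function.extend_apply' _ _ _ hi] using hx₀
    · refine (Fintype.sum_of_injective e e.injective _ _ (fun i hi => ?_) fun a => ?_).symm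
      · have : Function.extend e w 0 i = 0 := Function.extend_apply' _ _ _ hi
        simp [this]
      · simp [e.injective.extend_apply]
  · rintro _ ⟨⟨w, z⟩, ⟨hw, hz⟩, rfl⟩
    exact (convex_convexHull ℝ A).sum_mem (fun i _ => hw.1 i) hw.2
      fun i _ => subset_convexHull ℝ A (hz i trivial)

/-- A strictly separating functional, multiplied by `j ^ n + 1` along the curve, is a polynomial
nonnegative on `ℕ` on which `L` would be negative. -/
theorem scaled_moments_mem_convexHull {n : ℕ} (hn : 1 ≤ n) {m : Fin n → ℝ}
    (hm : ∀ Q : ℝ[X], Q.natDegree ≤ n → (∀ j : ℕ, 0 ≤ Q.eval (j : ℝ)) → 0 ≤ L Q m)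
    (hpos : 0 < moments m (Fin.last n) + 1) :
    (moments m (Fin.last n) + 1)⁻¹ • moments m ∈
      convexHull ℝ (insert (Pi.single (Fin.last n) 1) (Set.range (scaledCurve n))) := by
  by_contra hw
  obtain ⟨f, u, hfw, hfA⟩ := geometric_hahn_banach_point_closed (convex_convexHull ℝ _)
    (isCompact_convexHull_of_isCompact (tendsto_scaledCurve hn).isCompact_insert_range).isClosed hw
  have hf (x : Fin (n + 1) → ℝ) : f x = ∑ k, f (Pi.single k 1) * x k :=
    linearMap_apply_eq_sum_single (f : (Fin (n + 1) → ℝ) →ₗ[ℝ] ℝ) x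
  set F : ℝ[X] := ofFn (n + 1) fun k => f (Pi.single k 1) with hF
  have hGdeg : (X ^ n + 1 : ℝ[X]).natDegree = n := by
    simpa using natDegree_X_pow_add_C (n := n) (r := (1 : ℝ))
  have hdeg : (F - u • (X ^ n + 1)).natDegree ≤ n :=
    (natDegree_sub_le _ _).trans (max_le (natDegree_ofFn_le _)
      ((natDegree_smul_le _ _).trans hGdeg.le))
  have hnn : ∀ j : ℕ, 0 ≤ (F - u • (X ^ n + 1)).eval (j : ℝ) := by
    intro j
    have h := hfA (scaledCurve n j) (subset_convexHull ℝ _ (Or.inr ⟨j, rfl⟩))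
    have e := sum_coeff_mul_scaledCurve (natDegree_ofFn_le fun k => f (Pi.single k 1)) j
    simp_rw [coeff_ofFn] at e
    rw [hf, e, lt_div_iff₀ (by positivity)] at h
    simp only [eval_sub, eval_smul, eval_add, eval_pow, eval_X, eval_one, smul_eq_mul, hF]
    linarith
  have hL := hm _ hdeg hnn
  have e₁ : L F m = f (moments m) := by rw [hF, L_ofFn, hf]
  have e₂ : L (X ^ n + 1) m = moments m (Fin.last n) + 1 := by
    have := L_X_pow m (Fin.last n)
    rw [Fin.val_last] at this
    rw [← momentFunctional_apply, map_add, momentFunctional_apply, momentFunctional_apply,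
      this, L_one]
  rw [← momentFunctional_apply, map_sub, map_smul, momentFunctional_apply, momentFunctional_apply,
    e₁, e₂, smul_eq_mul] at hL
  rw [map_smul, smul_eq_mul, inv_mul_lt_iff₀ hpos] at hfw
  linarith

/-- A functional that is nonnegative on polynomials nonnegative on `ℕ` is a finite sum of point
evaluations plus a multiple of the top coefficient. -/
theorem exists_atoms {n : ℕ} (hn : 1 ≤ n) {m : Fin n → ℝ}
    (hm : ∀ Q : ℝ[X], Q.natDegree ≤ n → (∀ j : ℕ, 0 ≤ Q.eval (j : ℝ)) → 0 ≤ L Q m) :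
    ∃ (s : Finset ℕ) (a : ℕ → ℝ) (c : ℝ), (∀ j ∈ s, 0 ≤ a j) ∧ 0 ≤ c ∧
      ∀ Q : ℝ[X], Q.natDegree ≤ n → L Q m = ∑ j ∈ s, a j * Q.eval (j : ℝ) + c * Q.coeff n := by
  have hpos : 0 < moments m (Fin.last n) + 1 := by
    have := hm (X ^ n) (natDegree_X_pow_le n) fun j => by simp
    have e := L_X_pow m (Fin.last n)
    rw [Fin.val_last] at e
    linarith
  have hw := scaled_moments_mem_convexHull hn hm hpos
  set M := moments m (Fin.last n) + 1 with hM
  rw [convexHull_insert (Set.range_nonempty _), convexJoin_singleton_left] at hw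
  obtain ⟨y, hy, hseg⟩ := Set.mem_iUnion₂.1 hw
  obtain ⟨a, b, ha, hb, -, hab⟩ := hseg
  rw [convexHull_range_eq_exists_affineCombination] at hy
  obtain ⟨s, w, hw₀, hw₁, rfl⟩ := hy
  rw [s.affineCombination_eq_linear_combination _ _ hw₁] at hab
  -- Undoing both scalings gives the atoms; the weight at the limit point becomes the coefficient of
  -- the top-degree functional.
  refine ⟨s, fun j => M * b * w j / ((j : ℝ) ^ n + 1), M * a, fun j hj => ?_, by positivity,
    fun Q hQ => ?_⟩
  · have := hw₀ j hj
    positivity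
  · have hmom (k : Fin (n + 1)) : moments m k =
        M * (a * (Pi.single (Fin.last n) 1 : Fin (n + 1) → ℝ) k +
          b * ∑ j ∈ s, w j * scaledCurve n j k) := by
      have := congrFun hab k
      simp only [Pi.add_apply, Pi.smul_apply, Finset.sum_apply, smul_eq_mul] at this
      rw [this, mul_inv_cancel_left₀ hpos.ne']
    have h₁ : ∑ k : Fin (n + 1), Q.coeff k * (Pi.single (Fin.last n) 1 : Fin (n + 1) → ℝ) k =
        Q.coeff n := by
      simp [Pi.single_apply]
    have h₂ : ∑ k : Fin (n + 1), Q.coeff k * ∑ j ∈ s, w j * scaledCurve n j k =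
        ∑ j ∈ s, w j * (Q.eval (j : ℝ) / ((j : ℝ) ^ n + 1)) := by
      simp_rw [← sum_coeff_mul_scaledCurve hQ, Finset.mul_sum]
      rw [Finset.sum_comm]
      exact Finset.sum_congr rfl fun j _ => Finset.sum_congr rfl fun k _ => by ring
    have h₃ : L Q m = M * a * (∑ k : Fin (n + 1), Q.coeff k *
        (Pi.single (Fin.last n) 1 : Fin (n + 1) → ℝ) k) +
        M * b * ∑ k : Fin (n + 1), Q.coeff k * ∑ j ∈ s, w j * scaledCurve n j k := by
      rw [L, Finset.mul_sum, Finset.mul_sum, ← Finset.sum_add_distrib]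
      exact Finset.sum_congr rfl fun k _ => by rw [hmom]; ring
    rw [h₃, h₁, h₂, Finset.mul_sum, add_comm]
    congr 1
    exact Finset.sum_congr rfl fun j _ => by ring

/-! ### Realizable vectors and weak separation -/

/-- Weak separation of a point from a convex set in finite dimension. -/
theorem exists_ne_zero_forall_le_of_notMem {E : Type*} [NormedAddCommGroup E] [NormedSpace ℝ E]
    [FiniteDimensional ℝ E] {A : Set E} (hA : Convex ℝ A) (hne : A.Nonempty) {x : E}
    (hx : x ∉ A) : ∃ f : E →ₗ[ℝ] ℝ, f ≠ 0 ∧ ∀ a ∈ A, f a ≤ f x := by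
  by_cases hint : (interior A).Nonempty
  · obtain ⟨f, hf, h⟩ := geometric_hahn_banach_of_nonempty_interior_point hA
      (fun h => hx (interior_subset h)) hint
    exact ⟨f, fun h0 => hf (ContinuousLinearMap.coe_injective h0), h⟩
  -- With empty interior, some nonzero functional is constant on `A`; its sign can be chosen freely.
  · rw [hA.interior_nonempty_iff_affineSpan_eq_top,
      AffineSubspace.affineSpan_eq_top_iff_vectorSpan_eq_top_of_nonempty ℝ E E hne] at hint
    obtain ⟨f, hf, hker⟩ := Submodule.exists_le_ker_of_lt_top _ (lt_top_iff_ne_top.2 hint)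
    have hconst : ∀ a ∈ A, ∀ b ∈ A, f a = f b := fun a ha b hb =>
      sub_eq_zero.1 (by rw [← map_sub]; exact hker (vsub_mem_vectorSpan ℝ ha hb))
    obtain ⟨b, hb⟩ := hne
    rcases le_total (f b) (f x) with h | h
    · exact ⟨f, hf, fun a ha => (hconst a ha b hb).trans_le h⟩
    · refine ⟨-f, neg_ne_zero.2 hf, fun a ha => ?_⟩
      simpa [hconst a ha b hb] using h

/-- The first `n` positive powers of `j`. -/
def momentCurve (n j : ℕ) : Fin n → ℝ := fun i => (j : ℝ) ^ ((i : ℕ) + 1)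

theorem realizable_momentCurve (n j : ℕ) : Realizable (momentCurve n j) :=
  ⟨Measure.dirac j, inferInstance, fun i => ⟨integrable_dirac (by simp), by simp [momentCurve]⟩⟩

theorem convex_realizable (n : ℕ) : Convex ℝ {m : Fin n → ℝ | Realizable m} := by
  rintro x ⟨μ, hμ, hx⟩ y ⟨ν, hν, hy⟩ a b ha hb hab
  refine ⟨ENNReal.ofReal a • μ + ENNReal.ofReal b • ν, ⟨?_⟩, fun i => ?_⟩
  · simp [← ENNReal.ofReal_add ha hb, hab]
  · have h₁ := (hx i).1.smul_measure (c := ENNReal.ofReal a) ENNReal.ofReal_ne_top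
    have h₂ := (hy i).1.smul_measure (c := ENNReal.ofReal b) ENNReal.ofReal_ne_top
    refine ⟨h₁.add_measure h₂, ?_⟩
    rw [integral_add_measure h₁ h₂, integral_smul_measure, integral_smul_measure, (hx i).2,
      (hy i).2]
    simp [ha, hb]

theorem realizable_of_atoms {n : ℕ} {m : Fin n → ℝ} {s : Finset ℕ} {a : ℕ → ℝ}
    (ha : ∀ j ∈ s, 0 ≤ a j)
    (h : ∀ Q : ℝ[X], Q.natDegree ≤ n → L Q m = ∑ j ∈ s, a j * Q.eval (j : ℝ)) :
    Realizable m := by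
  have h₁ : ∑ j ∈ s, a j = 1 := by simpa [L_one] using (h 1 (by simp)).symm
  have hm : m = ∑ j ∈ s, a j • momentCurve n j := by
    ext i
    have := h (X ^ ((i : ℕ) + 1)) ((natDegree_X_pow_le _).trans i.2)
    rw [← Fin.val_succ, L_X_pow] at this
    simpa [moments, momentCurve] using this
  rw [hm]
  exact (convex_realizable n).sum_mem ha h₁ fun j _ => realizable_momentCurve n j

/-- A vector that is not realizable is weakly separated from the moment curve. -/
theorem exists_polynomial_of_not_realizable {n : ℕ} {m : Fin n → ℝ} (hm : ¬ Realizable m) :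
    ∃ Q : ℝ[X], Q ≠ 0 ∧ Q.natDegree ≤ n ∧ (∀ j : ℕ, 0 ≤ Q.eval (j : ℝ)) ∧ L Q m = 0 := by
  obtain ⟨f, hf, hle⟩ := exists_ne_zero_forall_le_of_notMem (convex_realizable n)
    ⟨_, realizable_momentCurve n 0⟩ (x := m) hm
  have hfx (x : Fin n → ℝ) : f x = ∑ k, f (Pi.single k 1) * x k :=
    linearMap_apply_eq_sum_single f x
  -- These are the coefficients of `f m - f (momentCurve n x)` as a polynomial in `x`.
  set p : Fin (n + 1) → ℝ := Fin.cons (f m) fun i => -f (Pi.single i 1) with hp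
  refine ⟨ofFn (n + 1) p, fun h0 => hf ?_, natDegree_ofFn_le p, fun j => ?_, ?_⟩
  · ext i
    have := coeff_ofFn p i.succ
    rw [h0, coeff_zero, hp, Fin.cons_succ] at this
    simpa using this.symm
  · have := hle _ (realizable_momentCurve n j)
    rw [hfx (momentCurve n j)] at this
    simpa [eval_ofFn, Fin.sum_univ_succ, hp, momentCurve] using this
  · simp [L_ofFn, Fin.sum_univ_succ, hp, moments, ← hfx]

theorem integrable_and_integral_eval {n : ℕ} {m : Fin n → ℝ} {μ : Measure ℕ}
    [IsProbabilityMeasure μ]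
    (hμ : ∀ i : Fin n, Integrable (fun j : ℕ => (j : ℝ) ^ ((i : ℕ) + 1)) μ ∧
      ∫ j : ℕ, (j : ℝ) ^ ((i : ℕ) + 1) ∂μ = m i) {Q : ℝ[X]} (hQ : Q.natDegree ≤ n) :
    Integrable (fun j : ℕ => Q.eval (j : ℝ)) μ ∧ ∫ j : ℕ, Q.eval (j : ℝ) ∂μ = L Q m := by
  have hk : ∀ k : Fin (n + 1), Integrable (fun j : ℕ => (j : ℝ) ^ (k : ℕ)) μ ∧
      ∫ j : ℕ, (j : ℝ) ^ (k : ℕ) ∂μ = moments m k := by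
    intro k
    refine Fin.cases ?_ (fun i => ?_) k
    · simp [moments]
    · simpa [moments] using hμ i
  simp_rw [eval_eq_sum_fin hQ]
  refine ⟨integrable_finsetSum _ fun k _ => (hk k).1.const_mul _, ?_⟩
  rw [integral_finsetSum _ fun k _ => (hk k).1.const_mul _, L]
  simp_rw [integral_const_mul, (hk _).2]

end TruncatedMoment

/-! ### The characterization -/

theorem mainTheorem1 (n : ℕ) (hn : 1 ≤ n) (m : Fin n → ℝ) :
    TruncatedMoment.Realizable m ↔
      (∀ P ∈ TruncatedMoment.PolySet n, 0 ≤ TruncatedMoment.L P m) ∧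
      (∀ P ∈ TruncatedMoment.PolySet (n - 1),
        0 ≤ TruncatedMoment.L P m ∧
          (TruncatedMoment.L P m = 0 → TruncatedMoment.L (Polynomial.X * P) m = 0)) := by
  open TruncatedMoment in
  constructor
  · rintro ⟨μ, hprob, hμ⟩
    refine ⟨fun P hP => ?_, fun P hP => ?_⟩
    · rw [← (integrable_and_integral_eval hμ hP.2.1.le).2]
      exact integral_nonneg hP.2.2.2
    · have hdeg : P.natDegree ≤ n := hP.2.1.trans_le (Nat.sub_le n 1)
      obtain ⟨hint, hP₀⟩ := integrable_and_integral_eval hμ hdeg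
      rw [← hP₀]
      refine ⟨integral_nonneg hP.2.2.2, fun h0 => ?_⟩
      rw [integral_eq_zero_iff_of_nonneg hP.2.2.2 hint] at h0
      have hXdeg : (X * P).natDegree ≤ n := natDegree_mul_le.trans (by
        rw [natDegree_X, hP.2.1]; omega)
      rw [← (integrable_and_integral_eval hμ hXdeg).2]
      refine integral_eq_zero_of_ae ?_
      filter_upwards [h0] with j hj
      simp only [Pi.zero_apply] at hj ⊢
      rw [eval_mul, hj, mul_zero]
  · rintro ⟨h₀, h₁⟩
    have hpoly := nonneg_polySet_of_le hn (momentFunctional m) h₀ fun P hP => (h₁ P hP).1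
    have hnn : ∀ Q : ℝ[X], Q.natDegree ≤ n → (∀ j : ℕ, 0 ≤ Q.eval (j : ℝ)) → 0 ≤ L Q m := by
      intro Q hQ h
      rcases eq_or_ne Q 0 with rfl | hne
      · simp [L]
      · exact nonneg_of_nonneg_polySet (momentFunctional m) hpoly hne hQ h
    obtain ⟨s, a, c, ha, hc, hL⟩ := exists_atoms hn hnn
    by_contra hreal
    have hc₀ : c ≠ 0 := by
      rintro rfl
      exact hreal (realizable_of_atoms ha fun Q hQ => by simpa using hL Q hQ)
    obtain ⟨Q, hQ, hQdeg, hQnn, hQL⟩ := exists_polynomial_of_not_realizable hreal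
    rw [hL Q hQdeg] at hQL
    have hterm : ∀ j ∈ s, 0 ≤ a j * Q.eval (j : ℝ) := fun j hj => mul_nonneg (ha j hj) (hQnn j)
    have hlead : 0 ≤ Q.coeff n := by
      rcases hQdeg.lt_or_eq with h | h
      · rw [coeff_eq_zero_of_natDegree_lt h]
      · rw [← h]
        exact (leadingCoeff_pos_of_nonneg hQ hQnn).le
    obtain ⟨hsum, htop⟩ := (add_eq_zero_iff_of_nonneg (Finset.sum_nonneg hterm)
      (mul_nonneg hc hlead)).1 hQL
    have hcoeff : Q.coeff n = 0 := (mul_eq_zero.1 htop).resolve_left hc₀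
    have hQdeg' : Q.natDegree ≤ n - 1 := by
      rcases hQdeg.lt_or_eq with h | h
      · omega
      · rw [← h] at hcoeff
        exact absurd (leadingCoeff_eq_zero.1 hcoeff) hQ
    obtain ⟨k, hk, P, hP, hroot⟩ := exists_mem_polySet_of_nonneg hQ hQnn
    obtain ⟨P', hP', hroot'⟩ := exists_mem_polySet_of_le (hk.trans hQdeg') hP
    -- Each atom either has zero weight or is a root of `Q`, hence of `P'`.
    have hvan : ∀ j ∈ s, a j * P'.eval (j : ℝ) = 0 := fun j hj => by
      rcases mul_eq_zero.1 ((Finset.sum_eq_zero_iff_of_nonneg hterm).1 hsum j hj) with h | h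
      · rw [h, zero_mul]
      · rw [hroot' j (hroot j h), mul_zero]
    have hP'L : L P' m = 0 := by
      rw [hL P' (hP'.2.1.trans_le (Nat.sub_le n 1)), Finset.sum_eq_zero hvan,
        coeff_eq_zero_of_natDegree_lt (by rw [hP'.2.1]; omega), mul_zero, add_zero]
    have hXdeg : (X * P').natDegree ≤ n := natDegree_mul_le.trans (by
      rw [natDegree_X, hP'.2.1]; omega)
    have hX := (h₁ P' hP').2 hP'L
    rw [hL _ hXdeg, Finset.sum_eq_zero fun j hj => by
      rw [eval_mul, mul_left_comm, hvan j hj, mul_zero]] at hX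
    have htopc : (X * P').coeff n = 1 := by
      obtain ⟨l, rfl⟩ := Nat.exists_eq_add_of_le' hn
      rw [coeff_X_mul]
      have : P'.natDegree = l := by simpa using hP'.2.1
      rw [← this]
      exact hP'.1
    rw [htopc, zero_add, mul_one] at hX
    exact hc₀ hX
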